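/- Let $d\ge 1$, let $\rho$ be the Euclidean distance and $dx$ Lebesgue measure on $\mathbb{R}^d$, and let $X_1,X_2,\dots$ be i.i.d. random vectors in $\mathbb{R}^d$ having a probability density $f$. Put $H=-\int_{\mathbb{R}^d} f(x)\log f(x)\,dx$, $S(f)=\{x: f(x)>0\}$, $V_d=\pi^{d/2}/\Gamma(d/2+1)$, $\gamma=-\int_0^\infty e^{-t}\log t\,dt$. For $N\ge 2$ let $\rho_i=\min_{j\ne i,\ 1\le j\le N}\rho(X_i,X_j)$, $1\le i\le N$, and let $$H_N = d\log\big((\rho_1\cdots\rho_N)^{1/N}\big)+\log V_d+\gamma+\log(N-1)$$ be the Kozachenko–Leonenko estimate. Let $G(t)=0$ for $0\le t<1$ and $G(t)=t\log t$ for $t\ge 1$; for $r>0$ let $I_f(x,r)=\frac{1}{r^dV_d}\int_{\{y:\rho(x,y)\le r\}}f(y)\,dy$, and for $R>0$ let $M_f(x,R)=\sup_{0<r\le R}I_f(x,r)$, $m_f(x,R)=\inf_{0<r\le R}I_f(x,r)$. Consider the functionals with values in $[0,\infty]$ $$K_f(\varepsilon)=\int_{\mathbb{R}^d}\Big(\int_{\mathbb{R}^d}G(|\log\rho(x,y)|)f(y)\,dy\Big)^{1+\varepsilon}f(x)\,dx,$$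 $$Q_f(\varepsilon,R)=\int_{\mathbb{R}^d}M_f(x,R)^{\varepsilon}f(x)\,dx,\qquad T_f(\varepsilon,R)=\int_{\mathbb{R}^d}m_f(x,R)^{-\varepsilon}f(x)\,dx,$$ and the conditions - (A): $\int_{\mathbb{R}^d}\int_{\mathbb{R}^d}|\log\rho(x,y)|^p f(x)f(y)\,dx\,dy<\infty$ for some $p>1$; - (B): some version of $f$ satisfies $f(x)\le M$ for all $x\in\mathbb{R}^d$, for some $M>0$; - (C1): some version of $f$ satisfies $f(x)\ge m$ for all $x\in S(f)$, for some $m>0$. Suppose that 1. $K_f(\varepsilon_0)<\infty$ for some $\varepsilon_0>0$, or (A) holds; and 2. $Q_f(\varepsilon_1,R_1)<\infty$ for some $\varepsilon_1,R_1>0$, or (B) holds; and 3. $T_f(\varepsilon_2,R_2)<\infty$ for some $\varepsilon_2,R_2>0$, or (C1) holds. Then $f\log f$ is integrable, $H_N$ is integrable for every $N\ge 2$, and $\mathsf{E}H_N\to H$ as $N\to\infty$. Moreover, the same conclusion holds if (B) and (C1) are satisfied and $f$ has a version with bounded support $S(f)$. -/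

import Mathlib

noncomputable section

namespace KL

/-- The Euclidean space of dimension `d`, with its Euclidean distance and Lebesgue measure. -/
abbrev E (d : ℕ) : Type := EuclideanSpace ℝ (Fin d)

/-- `f` is a probability density with respect to Lebesgue measure. -/
structure IsProbDensity {d : ℕ} (f : E d → ℝ) : Prop where
  measurable : Measurable f
  nonneg : ∀ x, 0 ≤ f x
  lintegral_eq_one : ∫⁻ x, ENNReal.ofReal (f x) = 1

/-- The probability law with density `f`. -/
def law {d : ℕ} (f : E d → ℝ) : MeasureTheory.Measure (E d) :=
  MeasureTheory.volume.withDensity (fun x => ENNReal.ofReal (f x))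

/-- `g` is a version of `f`: they agree Lebesgue-almost everywhere. -/
def IsVersion {d : ℕ} (g f : E d → ℝ) : Prop :=
  ∀ᵐ x ∂(MeasureTheory.volume : MeasureTheory.Measure (E d)), g x = f x

/-- The support `S(f) = {x | f x > 0}` (no closure is taken). -/
def supp {d : ℕ} (f : E d → ℝ) : Set (E d) := {x | 0 < f x}

/-- The differential entropy `H(f) = - ∫ f log f`. -/
def entropy {d : ℕ} (f : E d → ℝ) : ℝ := -∫ x, f x * Real.log (f x)

/-- The volume of the unit ball, `V_d = π ^ (d / 2) / Γ (d / 2 + 1)`. -/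
def unitBallVol (d : ℕ) : ℝ := Real.pi ^ ((d : ℝ) / 2) / Real.Gamma ((d : ℝ) / 2 + 1)

/-- The Euler constant `γ = - ∫_{(0, ∞)} e ^ (-t) log t dt`. -/
def eulerConst : ℝ := -∫ t in Set.Ioi (0 : ℝ), Real.exp (-t) * Real.log t

/-- The distance from the `i`-th sample point to its nearest neighbour among the other sample
points. For `2 ≤ N` this infimum runs over a finite nonempty index type, so it is a minimum. -/
def nnDist {d N : ℕ} (x : Fin N → E d) (i : Fin N) : ℝ :=
  ⨅ j : {j : Fin N // j ≠ i}, dist (x i) (x j)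

/-- The geometric mean of the nearest neighbour distances. -/
def meanDist {d N : ℕ} (x : Fin N → E d) : ℝ := (∏ i, nnDist x i) ^ ((1 : ℝ) / (N : ℝ))

/-- The Kozachenko-Leonenko entropy estimate computed from `N` sample points. -/
def estimate {d N : ℕ} (x : Fin N → E d) : ℝ :=
  (d : ℝ) * Real.log (meanDist x) + Real.log (unitBallVol d) + eulerConst
    + Real.log ((N : ℝ) - 1)

/-- The statistic `H_N`, computed from the first `N` terms of a sequence of random vectors. -/
def estimator {d : ℕ} {Ω : Type*} (X : ℕ → Ω → E d) (N : ℕ) (ω : Ω) : ℝ :=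
  estimate (fun i : Fin N => X i ω)

/-- `G t = 0` for `t < 1` and `G t = t log t` for `1 ≤ t`. -/
def G (t : ℝ) : ℝ := if t < 1 then 0 else t * Real.log t

/-- The average `I_f(x, r)` of `f` over the closed ball of centre `x` and radius `r`. -/
def ballAvg {d : ℕ} (f : E d → ℝ) (x : E d) (r : ℝ) : ENNReal :=
  (∫⁻ y in Metric.closedBall x r, ENNReal.ofReal (f y)) / ENNReal.ofReal (r ^ d * unitBallVol d)

/-- `M_f(x, R)`, the supremum of the averages over radii `0 < r ≤ R`. -/
def maxAvg {d : ℕ} (f : E d → ℝ) (x : E d) (R : ℝ) : ENNReal :=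
  ⨆ r ∈ Set.Ioc (0 : ℝ) R, ballAvg f x r

/-- `m_f(x, R)`, the infimum of the averages over radii `0 < r ≤ R`. -/
def minAvg {d : ℕ} (f : E d → ℝ) (x : E d) (R : ℝ) : ENNReal :=
  ⨅ r ∈ Set.Ioc (0 : ℝ) R, ballAvg f x r

/-- The functional `K_f(ε)`. The value of the inner integrand at `y = x` is irrelevant for
`0 < d`, points being Lebesgue-null. -/
def K {d : ℕ} (f : E d → ℝ) (ε : ℝ) : ENNReal :=
  ∫⁻ x : E d, (∫⁻ y : E d, ENNReal.ofReal (G |Real.log (dist x y)|) * ENNReal.ofReal (f y))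
    ^ (1 + ε) * ENNReal.ofReal (f x)

/-- The functional `Q_f(ε, R)`. -/
def Q {d : ℕ} (f : E d → ℝ) (ε R : ℝ) : ENNReal :=
  ∫⁻ x : E d, maxAvg f x R ^ ε * ENNReal.ofReal (f x)

/-- The functional `T_f(ε, R)`; in `ENNReal`, `0 ^ (-ε) = ⊤` for `0 < ε`, and `⊤ * 0 = 0`. -/
def T {d : ℕ} (f : E d → ℝ) (ε R : ℝ) : ENNReal :=
  ∫⁻ x : E d, minAvg f x R ^ (-ε) * ENNReal.ofReal (f x)

/-- `K_f(ε₀)` is finite for some `ε₀ > 0`. -/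
def FiniteK {d : ℕ} (f : E d → ℝ) : Prop := ∃ ε : ℝ, 0 < ε ∧ K f ε < ⊤

/-- `Q_f(ε₁, R₁)` is finite for some `ε₁ > 0`, `R₁ > 0`. -/
def FiniteQ {d : ℕ} (f : E d → ℝ) : Prop := ∃ ε R : ℝ, 0 < ε ∧ 0 < R ∧ Q f ε R < ⊤

/-- `T_f(ε₂, R₂)` is finite for some `ε₂ > 0`, `R₂ > 0`. -/
def FiniteT {d : ℕ} (f : E d → ℝ) : Prop := ∃ ε R : ℝ, 0 < ε ∧ 0 < R ∧ T f ε R < ⊤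

/-- Condition (A): a logarithmic moment of some order `p > 1` of the distance of two independent
points with density `f` is finite. -/
def CondA {d : ℕ} (f : E d → ℝ) : Prop :=
  ∃ p : ℝ, 1 < p ∧
    ∫⁻ x : E d, ∫⁻ y : E d, ENNReal.ofReal (|Real.log (dist x y)| ^ p)
      * ENNReal.ofReal (f x) * ENNReal.ofReal (f y) < ⊤

/-- Condition (B): some version of the density is bounded. -/
def CondB {d : ℕ} (f : E d → ℝ) : Prop :=
  ∃ g : E d → ℝ, IsVersion g f ∧ ∃ M : ℝ, 0 < M ∧ ∀ x, g x ≤ M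

/-- Condition (C1): some version of the density is bounded below by a positive constant on its
support. -/
def CondC1 {d : ℕ} (f : E d → ℝ) : Prop :=
  ∃ g : E d → ℝ, IsVersion g f ∧ ∃ m : ℝ, 0 < m ∧ ∀ x ∈ supp g, m ≤ g x

/-- Some version of the density has bounded support. -/
def BoundedSupport {d : ℕ} (f : E d → ℝ) : Prop :=
  ∃ g : E d → ℝ, IsVersion g f ∧ Bornology.IsBounded (supp g)

/-- The estimates `H_N` are asymptotically unbiased: `E H_N → H(f)`, where all the expectations
and the entropy are genuine (absolutely convergent) integrals. -/
def AsympUnbiased {d : ℕ} {Ω : Type*} [MeasurableSpace Ω] (P : MeasureTheory.Measure Ω)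
    (X : ℕ → Ω → E d) (f : E d → ℝ) : Prop :=
  (∀ N : ℕ, 2 ≤ N → MeasureTheory.Integrable (estimator X N) P) ∧
  MeasureTheory.Integrable (fun x : E d => f x * Real.log (f x)) ∧
  Filter.Tendsto (fun N : ℕ => ∫ ω, estimator X N ω ∂P) Filter.atTop (nhds (entropy f))

end KL

end

namespace KL

open MeasureTheory Filter Topology Set
open scoped ENNReal

/-! Write `N = n + 1`. Up to the constant `eulerConst`, the estimate is the average of the
identically distributed variables log(n V_d ρ_i^d), so its mean needs only their common tail. Given
X_i = x, this variable exceeds t exactly when the other n points miss the ball about x of volume e^t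
/ n. Hence the tail is `isolProb (law f) n (nnRadius d n t)`.

By Lebesgue differentiation the ball has mass about f(x) e^t / n, so the tail converges to the mean
of exp(-f(x) e^t) under `law f` (`tendsto_isolProb_nnRadius`). For fixed x this is the tail of log(S
/ f(x)) with S standard exponential, whose mean is -γ - log f(x) (`lintegral_exp_neg_mul_exp_sub`).
Averaging over x and adding γ gives the entropy.

It remains to take the limit under the integrals over t. The lower tail is dominated by a multiple
of e^(-δt), through the maximal averages (`one_sub_isolProb_nnRadius_le`). The upper tail is split
at radius 1. Below it, a Fubini argument over balls of half the radius gives an n-free bound for any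
law (`isolProb_le_add`), integrable when log⁺ dist has a finite mean. Above it, the contribution
tends to 0, with the case n = 1 as dominating function (`tendsto_lintegral_isolProb_far`). -/

/-! ### Tail formulas and the exponential law. -/

/-- The expectation of a real random variable, computed from its tail function. -/
theorem integrable_and_integral_eq_of_tail {α : Type*} [MeasurableSpace α] {P : Measure α}
    [IsProbabilityMeasure P] {Z : α → ℝ} (hZ : Measurable Z) {τ : ℝ → ℝ≥0∞}
    (hτ : ∀ t, P {a | t < Z a} = τ t) (hpos : ∫⁻ t in Ioi 0, τ t ≠ ⊤)
    (hneg : ∫⁻ t in Ioi 0, (1 - τ (-t)) ≠ ⊤) :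
    Integrable Z P ∧
      ∫ a, Z a ∂P = (∫⁻ t in Ioi 0, τ t).toReal - (∫⁻ t in Ioi 0, (1 - τ (-t))).toReal := by
  have h1 : ∫⁻ a, ENNReal.ofReal (Z a) ∂P = ∫⁻ t in Ioi 0, τ t := by
    have h := lintegral_eq_lintegral_meas_lt (f := fun a => max (Z a) 0) P
      (ae_of_all _ fun a => le_max_right _ _) (hZ.max measurable_const).aemeasurable
    simp only [ENNReal.ofReal_max, ENNReal.ofReal_zero, max_eq_left (zero_le)] at h
    rw [h]
    refine setLIntegral_congr_fun measurableSet_Ioi fun t ht => ?_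
    have ht' : ¬ t < 0 := not_lt.2 (le_of_lt ht)
    simp only [lt_max_iff, ht', or_false]
    exact hτ t
  have h2 : ∫⁻ a, ENNReal.ofReal (-Z a) ∂P = ∫⁻ t in Ioi 0, (1 - τ (-t)) := by
    -- The non-strict layer-cake formula is the right one here: `{t ≤ -Z}` is exactly the complement
    -- of `{-t < Z}`.
    have h := lintegral_eq_lintegral_meas_le (f := fun a => max (-Z a) 0) P
      (ae_of_all _ fun a => le_max_right _ _) (hZ.neg.max measurable_const).aemeasurable
    simp only [ENNReal.ofReal_max, ENNReal.ofReal_zero, max_eq_left (zero_le)] at h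
    rw [h]
    refine setLIntegral_congr_fun measurableSet_Ioi fun t ht => ?_
    have ht' : ¬ t ≤ 0 := not_le.2 ht
    simp only [le_max_iff, ht', or_false]
    rw [← hτ, ← prob_compl_eq_one_sub (measurableSet_lt measurable_const hZ)]
    congr 1
    ext a
    simp only [mem_ofPred_eq, mem_compl_iff, not_lt]
    constructor <;> intro h <;> linarith
  have hint : Integrable Z P := by
    refine ⟨hZ.aestronglyMeasurable, ?_⟩
    rw [hasFiniteIntegral_iff_norm]
    have : ∀ a, ENNReal.ofReal ‖Z a‖ = ENNReal.ofReal (Z a) + ENNReal.ofReal (-Z a) := by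
      intro a
      rcases le_total 0 (Z a) with h | h
      · rw [Real.norm_of_nonneg h, ENNReal.ofReal_of_nonpos (by linarith : -Z a ≤ 0), add_zero]
      · rw [Real.norm_of_nonpos h, ENNReal.ofReal_of_nonpos h, zero_add]
    simp_rw [this]
    rw [lintegral_add_left hZ.ennreal_ofReal, h1, h2]
    exact ENNReal.add_lt_top.2 ⟨hpos.lt_top, hneg.lt_top⟩
  exact ⟨hint, by rw [integral_eq_lintegral_pos_part_sub_lintegral_neg_part hint, h1, h2]⟩

theorem lintegral_exp_neg_mul_Ioi {c : ℝ} (hc : 0 < c) :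
    ∫⁻ t in Ioi (0 : ℝ), ENNReal.ofReal (Real.exp (-(c * t))) = ENNReal.ofReal (1 / c) := by
  have h := integral_exp_mul_Ioi (a := -c) (by linarith) 0
  have hi := integrableOn_exp_mul_Ioi (a := -c) (by linarith) 0
  rw [← ofReal_integral_eq_lintegral_ofReal]
  · congr 1
    simp only [neg_mul, mul_zero, Real.exp_zero] at h
    rw [h]; field_simp
  · simpa only [neg_mul, IntegrableOn] using hi
  · exact ae_of_all _ fun t => (Real.exp_pos _).le

theorem lintegral_exp_neg_mul_Ioi_ne_top {c : ℝ} (hc : 0 < c) :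
    ∫⁻ t in Ioi (0 : ℝ), ENNReal.ofReal (Real.exp (-(c * t))) ≠ ⊤ := by
  rw [lintegral_exp_neg_mul_Ioi hc]; exact ENNReal.ofReal_ne_top

/-- The law with density `exp (-s)` on the positive half-line. -/
noncomputable def stdExp : Measure ℝ :=
  (volume.restrict (Ioi 0)).withDensity fun s => ENNReal.ofReal (Real.exp (-s))

theorem stdExp_Ioi {c : ℝ} (hc : 0 ≤ c) :
    stdExp (Ioi c) = ENNReal.ofReal (Real.exp (-c)) := by
  rw [stdExp, withDensity_apply _ measurableSet_Ioi, Measure.restrict_restrict measurableSet_Ioi,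
    Ioi_inter_Ioi, sup_of_le_left hc, ← ofReal_integral_eq_lintegral_ofReal,
    integral_exp_neg_Ioi]
  · exact integrableOn_exp_neg_Ioi c
  · exact ae_of_all _ fun t => (Real.exp_pos _).le

theorem stdExp_compl_Ioi : stdExp (Ioi 0)ᶜ = 0 := by
  rw [stdExp, withDensity_apply _ measurableSet_Ioi.compl,
    Measure.restrict_restrict measurableSet_Ioi.compl, compl_inter_self]
  simp

theorem ae_stdExp : ∀ᵐ s ∂stdExp, 0 < s := by
  rw [ae_iff]
  exact stdExp_compl_Ioi

instance : IsProbabilityMeasure stdExp := by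
  constructor
  have := measure_add_measure_compl (μ := stdExp) (measurableSet_Ioi (a := (0 : ℝ)))
  rw [← this, stdExp_Ioi le_rfl, stdExp_compl_Ioi]
  simp

theorem one_sub_ofReal_exp_neg_le (x : ℝ) :
    1 - ENNReal.ofReal (Real.exp (-x)) ≤ ENNReal.ofReal x := by
  rw [← ENNReal.ofReal_one, ← ENNReal.ofReal_sub _ (Real.exp_pos _).le]
  apply ENNReal.ofReal_le_ofReal
  have := Real.add_one_le_exp (-x)
  linarith

/-- The two integrals are the positive and negative parts of the mean of log(S / a) for S standard
exponential, and log S has mean -γ. -/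
theorem lintegral_exp_neg_mul_exp_sub {a : ℝ} (ha : 0 < a) :
    (∫⁻ t in Ioi (0 : ℝ), ENNReal.ofReal (Real.exp (-(a * Real.exp t)))).toReal -
      (∫⁻ t in Ioi (0 : ℝ), (1 - ENNReal.ofReal (Real.exp (-(a * Real.exp (-t)))))).toReal =
      -eulerConst - Real.log a := by
  set Z : ℝ → ℝ := fun s => Real.log (s / a)
  have hZ : Measurable Z := Real.measurable_log.comp (measurable_id.div_const a)
  have htail : ∀ t, stdExp {s | t < Z s} = ENNReal.ofReal (Real.exp (-(a * Real.exp t))) := by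
    intro t
    rw [← stdExp_Ioi (by positivity)]
    apply measure_congr
    filter_upwards [ae_stdExp] with s hs
    apply propext
    change t < Real.log (s / a) ↔ a * Real.exp t < s
    rw [Real.lt_log_iff_exp_lt (by positivity), lt_div_iff₀ ha, mul_comm]
  have hpos : ∫⁻ t in Ioi (0 : ℝ), ENNReal.ofReal (Real.exp (-(a * Real.exp t))) ≠ ⊤ := by
    refine ne_top_of_le_ne_top (lintegral_exp_neg_mul_Ioi_ne_top ha) ?_
    refine lintegral_mono fun t => ENNReal.ofReal_le_ofReal (Real.exp_le_exp.2 ?_)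
    have := Real.add_one_le_exp t
    nlinarith
  have hneg : ∫⁻ t in Ioi (0 : ℝ),
      (1 - ENNReal.ofReal (Real.exp (-(a * Real.exp (-t))))) ≠ ⊤ := by
    have : ∫⁻ t in Ioi (0 : ℝ), ENNReal.ofReal a * ENNReal.ofReal (Real.exp (-(1 * t))) ≠ ⊤ := by
      rw [lintegral_const_mul' _ _ ENNReal.ofReal_ne_top]
      exact ENNReal.mul_ne_top ENNReal.ofReal_ne_top (lintegral_exp_neg_mul_Ioi_ne_top one_pos)
    refine ne_top_of_le_ne_top this (lintegral_mono fun t => ?_)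
    rw [← ENNReal.ofReal_mul ha.le, one_mul]
    exact one_sub_ofReal_exp_neg_le _
  obtain ⟨hint, heq⟩ := integrable_and_integral_eq_of_tail hZ htail hpos hneg
  have hc : ∫ s, Z s ∂stdExp = -eulerConst - Real.log a := by
    have h1 : ∫ s, Z s ∂stdExp = ∫ s, (Real.log s - Real.log a) ∂stdExp := by
      apply integral_congr_ae
      filter_upwards [ae_stdExp] with s hs
      exact Real.log_div hs.ne' ha.ne'
    have hi : Integrable Real.log stdExp := by
      have : Integrable (fun s => Z s + Real.log a) stdExp := hint.add (integrable_const _)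
      refine this.congr ?_
      filter_upwards [ae_stdExp] with s hs
      change Real.log (s / a) + _ = _
      rw [Real.log_div hs.ne' ha.ne']; ring
    rw [h1, integral_sub hi (integrable_const _), integral_const]
    simp only [probReal_univ, one_smul, eulerConst, neg_neg]
    congr 1
    rw [stdExp, integral_withDensity_eq_integral_toReal_smul (by fun_prop)
      (ae_of_all _ fun _ => ENNReal.ofReal_lt_top)]
    simp only [ENNReal.toReal_ofReal (Real.exp_pos _).le, smul_eq_mul]
  rw [← hc, heq]

/-! ### Laws with a density, volumes of balls, elementary inequalities. -/

theorem lintegral_law {d : ℕ} {f : E d → ℝ} (hf : IsProbDensity f) (g : E d → ℝ≥0∞) :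
    ∫⁻ x, g x ∂law f = ∫⁻ x, g x * ENNReal.ofReal (f x) := by
  rw [law, lintegral_withDensity_eq_lintegral_mul_non_measurable _ hf.measurable.ennreal_ofReal
    (ae_of_all _ fun _ => ENNReal.ofReal_lt_top)]
  simp only [Pi.mul_apply, mul_comm]

theorem law_apply {d : ℕ} (f : E d → ℝ) {s : Set (E d)} (hs : MeasurableSet s) :
    law f s = ∫⁻ y in s, ENNReal.ofReal (f y) :=
  withDensity_apply _ hs

theorem law_absolutelyContinuous {d : ℕ} (f : E d → ℝ) : law f ≪ volume :=
  withDensity_absolutelyContinuous _ _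

theorem isProbabilityMeasure_law {d : ℕ} {f : E d → ℝ} (hf : IsProbDensity f) :
    IsProbabilityMeasure (law f) :=
  ⟨by rw [law_apply f MeasurableSet.univ, Measure.restrict_univ, hf.lintegral_eq_one]⟩

theorem ae_law_pos {d : ℕ} {f : E d → ℝ} (hf : IsProbDensity f) : ∀ᵐ x ∂law f, 0 < f x := by
  rw [law, ae_withDensity_iff hf.measurable.ennreal_ofReal]
  exact ae_of_all _ fun x hx => ENNReal.ofReal_pos.1 (pos_iff_ne_zero.2 hx)

theorem unitBallVol_pos (d : ℕ) : 0 < unitBallVol d := by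
  unfold unitBallVol
  have : 0 < Real.Gamma ((d : ℝ) / 2 + 1) := Real.Gamma_pos_of_pos (by positivity)
  positivity

theorem volume_closedBall_eq {d : ℕ} (hd : 0 < d) (x : E d) {r : ℝ} (hr : 0 ≤ r) :
    volume (Metric.closedBall x r) = ENNReal.ofReal (r ^ d * unitBallVol d) := by
  have : Nonempty (Fin d) := ⟨⟨0, hd⟩⟩
  rw [EuclideanSpace.volume_closedBall, ENNReal.ofReal_mul (by positivity),
    ENNReal.ofReal_pow hr, Fintype.card_fin, unitBallVol]
  congr 3
  rw [Real.sqrt_eq_rpow, ← Real.rpow_natCast, ← Real.rpow_mul Real.pi_pos.le]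
  congr 1
  ring

theorem lintegral_ofReal_eq_lintegral_meas_lt {α : Type*} [MeasurableSpace α] (P : Measure α)
    {Z : α → ℝ} (hZ : Measurable Z) :
    ∫⁻ a, ENNReal.ofReal (Z a) ∂P = ∫⁻ t in Ioi (0 : ℝ), P {a | t < Z a} := by
  have h := lintegral_eq_lintegral_meas_lt (f := fun a => max (Z a) 0) P
    (ae_of_all _ fun a => le_max_right _ _) (hZ.max measurable_const).aemeasurable
  simp only [ENNReal.ofReal_max, ENNReal.ofReal_zero, max_eq_left (zero_le)] at h
  rw [h]
  refine setLIntegral_congr_fun measurableSet_Ioi fun t ht => ?_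
  have ht' : ¬ t < 0 := not_lt.2 (le_of_lt ht)
  simp only [lt_max_iff, ht', or_false]

/-- By Bernoulli, n m ≤ (1 + m)^n, and (1 + m)^n (1 - m)^n = (1 - m²)^n ≤ 1. -/
theorem nat_mul_mul_one_sub_pow_le_one (n : ℕ) {m : ℝ≥0∞} (hm : m ≤ 1) :
    (n : ℝ≥0∞) * (m * (1 - m) ^ n) ≤ 1 := by
  obtain ⟨a, ha0, rfl⟩ : ∃ a : ℝ, 0 ≤ a ∧ m = ENNReal.ofReal a :=
    ⟨m.toReal, ENNReal.toReal_nonneg,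
      (ENNReal.ofReal_toReal (ne_top_of_le_ne_top ENNReal.one_ne_top hm)).symm⟩
  have ha1 : a ≤ 1 := ENNReal.ofReal_le_one.1 hm
  rw [← ENNReal.ofReal_one, ← ENNReal.ofReal_sub _ ha0, ← ENNReal.ofReal_pow (by linarith),
    ← ENNReal.ofReal_mul ha0, ← ENNReal.ofReal_natCast, ← ENNReal.ofReal_mul (by positivity)]
  apply ENNReal.ofReal_le_ofReal
  have h1 := one_add_mul_le_pow (a := a) (by linarith) n
  have h2 : (1 + a) ^ n * (1 - a) ^ n ≤ 1 := by
    rw [← mul_pow]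
    exact pow_le_one₀ (mul_nonneg (by linarith) (by linarith)) (by nlinarith)
  have h3 : 0 ≤ (1 - a) ^ n := pow_nonneg (by linarith) _
  nlinarith [mul_le_mul_of_nonneg_right h1 h3]

/-! ### Isolation probabilities for an arbitrary law. -/

section

variable {d : ℕ} (μ : Measure (E d))

/-- The probability that none of `n` independent points of law `μ` lies within distance `r` of
another independent point of law `μ`. -/
noncomputable def isolProb (n : ℕ) (r : ℝ) : ℝ≥0∞ :=
  ∫⁻ x, (1 - μ (Metric.closedBall x r)) ^ n ∂μ

theorem measurable_measure_closedBall [SFinite μ] (r : ℝ) :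
    Measurable fun x : E d => μ (Metric.closedBall x r) := by
  have : MeasurableSet {p : E d × E d | dist p.2 p.1 ≤ r} :=
    measurableSet_le (by fun_prop) measurable_const
  exact measurable_measure_prodMk_left this

theorem measurable_one_sub_measure_closedBall_pow [SFinite μ] (n : ℕ) (r : ℝ) :
    Measurable fun x : E d => (1 - μ (Metric.closedBall x r)) ^ n :=
  (measurable_const.sub (measurable_measure_closedBall μ r)).pow_const n

theorem isolProb_anti_radius (n : ℕ) {r s : ℝ} (h : r ≤ s) : isolProb μ n s ≤ isolProb μ n r :=
  lintegral_mono fun _ => pow_le_pow_left₀ (zero_le)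
    (tsub_le_tsub_left (measure_mono (Metric.closedBall_subset_closedBall h)) _) n

theorem isolProb_anti_card {m n : ℕ} (h : m ≤ n) (r : ℝ) : isolProb μ n r ≤ isolProb μ m r :=
  lintegral_mono fun _ => pow_le_pow_right_of_le_one' tsub_le_self h

theorem measurable_isolProb (n : ℕ) : Measurable (isolProb μ n) :=
  Antitone.measurable fun _ _ h => isolProb_anti_radius μ n h

variable [IsProbabilityMeasure μ]

theorem isolProb_le_one (n : ℕ) (r : ℝ) : isolProb μ n r ≤ 1 := by
  calc isolProb μ n r ≤ ∫⁻ _, 1 ∂μ :=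
        lintegral_mono fun x => pow_le_one₀ (zero_le) tsub_le_self
    _ = 1 := by simp

theorem isolProb_zero_radius [NullSingletonClass μ] (n : ℕ) : isolProb μ n 0 = 1 := by
  simp [isolProb]

theorem isolProb_one (r : ℝ) :
    isolProb μ 1 r = (μ.prod μ) {p | r < dist p.1 p.2} := by
  rw [Measure.prod_apply (measurableSet_lt measurable_const (by fun_prop))]
  refine lintegral_congr fun x => ?_
  rw [pow_one, ← prob_compl_eq_one_sub measurableSet_closedBall]
  congr 1
  ext y
  simp [dist_comm]

/-- Almost every point lies in the support of `μ`, where every ball has positive mass, so the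
integrand decays geometrically. -/
theorem tendsto_isolProb_zero {r : ℝ} (hr : 0 < r) :
    Tendsto (fun n => isolProb μ n r) atTop (𝓝 0) := by
  have h : Tendsto (fun n => isolProb μ n r) atTop (𝓝 (∫⁻ _, 0 ∂μ)) := by
    refine tendsto_lintegral_of_dominated_convergence (fun _ => 1)
      (fun n => measurable_one_sub_measure_closedBall_pow μ n r)
      (fun n => ae_of_all _ fun x => pow_le_one₀ (zero_le) tsub_le_self) (by simp) ?_
    filter_upwards [Measure.support_mem_ae (μ := μ)] with x hx
    have hpos := (Measure.mem_support_iff_forall x).1 hx _ (Metric.closedBall_mem_nhds x hr)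
    exact ENNReal.tendsto_pow_atTop_nhds_zero_of_lt_one
      (ENNReal.sub_lt_self ENNReal.one_ne_top one_ne_zero hpos.ne')
  simpa using h

theorem lintegral_isolProb_one (hd : 0 < d) :
    ∫⁻ t in Ioi (0 : ℝ), isolProb μ 1 (Real.exp (t / d)) =
      d * ∫⁻ x, ∫⁻ y, ENNReal.ofReal (Real.log (dist x y)) ∂μ ∂μ := by
  have hd' : (0 : ℝ) < d := by exact_mod_cast hd
  have hm : Measurable fun p : E d × E d => Real.log (dist p.1 p.2) :=
    Real.measurable_log.comp (by fun_prop)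
  rw [← lintegral_prod (fun p : E d × E d => ENNReal.ofReal (Real.log (dist p.1 p.2)))
    hm.ennreal_ofReal.aemeasurable, ← lintegral_const_mul _ hm.ennreal_ofReal]
  simp_rw [← ENNReal.ofReal_natCast d, ← ENNReal.ofReal_mul hd'.le]
  rw [lintegral_ofReal_eq_lintegral_meas_lt _ (hm.const_mul _)]
  refine setLIntegral_congr_fun measurableSet_Ioi fun t ht => ?_
  have ht : 0 < t := ht
  simp only [isolProb_one]
  congr 1
  ext p
  simp only [mem_ofPred_eq]
  -- For coincident points `Real.log 0 = 0`, and both inequalities fail because t > 0.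
  rcases (dist_nonneg (x := p.1) (y := p.2)).eq_or_lt with h | h
  · rw [← h, Real.log_zero, mul_zero]
    exact iff_of_false (not_lt.2 (Real.exp_pos _).le) (not_lt.2 ht.le)
  · rw [← Real.lt_log_iff_exp_lt h, div_lt_iff₀ hd', mul_comm]

/-- An upper bound for the probability of isolation at scale `r` inside a ball, by averaging over
the centres of balls of radius `r / 2`. It needs no regularity of `μ`. -/
theorem setLIntegral_one_sub_measure_closedBall_pow_le (n : ℕ) (y : E d) (D r : ℝ) :
    n * (volume (Metric.closedBall (0 : E d) (r / 2)) *
      ∫⁻ x in Metric.closedBall y D, (1 - μ (Metric.closedBall x r)) ^ n ∂μ) ≤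
      volume (Metric.closedBall y (D + r / 2)) := by
  set A := Metric.closedBall y D
  set g : E d → ℝ≥0∞ := fun z => (1 - μ (Metric.closedBall z (r / 2))) ^ n
  have hg : Measurable g := measurable_one_sub_measure_closedBall_pow μ n (r / 2)
  set S : Set (E d × E d) := {p | dist p.2 p.1 ≤ r / 2}
  have hS : MeasurableSet S := measurableSet_le (by fun_prop) measurable_const
  set F : E d × E d → ℝ≥0∞ := S.indicator fun p => g p.2
  have hF : Measurable F := (hg.comp measurable_snd).indicator hS
  -- Every z within r / 2 of x has its ball of radius r / 2 inside the ball of radius r about x, so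
  -- passing to z only increases the power.
  have h1 : ∀ x, volume (Metric.closedBall (0 : E d) (r / 2)) *
      (1 - μ (Metric.closedBall x r)) ^ n ≤ ∫⁻ z, F (x, z) := by
    intro x
    have hx : ∀ z, F (x, z) = (Metric.closedBall x (r / 2)).indicator g z := fun z => by
      simp only [F, S, indicator, mem_ofPred_eq, Metric.mem_closedBall]
    simp_rw [hx]
    rw [lintegral_indicator measurableSet_closedBall, ← Measure.addHaar_closedBall_center _ x,
      mul_comm, ← setLIntegral_const]
    refine setLIntegral_mono hg fun z hz => ?_
    refine pow_le_pow_left₀ (zero_le) (tsub_le_tsub_left (measure_mono ?_) _) n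
    refine Metric.closedBall_subset_closedBall' ?_
    have := Metric.mem_closedBall.1 hz
    linarith
  calc _ ≤ n * ∫⁻ x in A, (∫⁻ z, F (x, z)) ∂μ := by
        gcongr
        rw [← lintegral_const_mul _ (measurable_one_sub_measure_closedBall_pow μ n r)]
        exact lintegral_mono h1
    _ = n * ∫⁻ z, ∫⁻ x in A, F (x, z) ∂μ := by
        rw [lintegral_lintegral_swap (f := fun x z => F (x, z)) hF.aemeasurable]
    _ = ∫⁻ z, n * (μ (A ∩ Metric.closedBall z (r / 2)) * g z) := by
        rw [← lintegral_const_mul _ hF.lintegral_prod_left']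
        refine lintegral_congr fun z => ?_
        congr 1
        have hz : ∀ x, F (x, z) = (Metric.closedBall z (r / 2)).indicator (fun _ => g z) x :=
          fun x => by
            simp only [F, S, indicator, mem_ofPred_eq, Metric.mem_closedBall, dist_comm]
        simp_rw [hz]
        rw [lintegral_indicator measurableSet_closedBall, setLIntegral_const,
          Measure.restrict_apply measurableSet_closedBall, inter_comm, mul_comm]
    -- After the swap, the mass m of the small ball appears beside (1 - m)^n, and n m (1 - m)^n ≤ 1.
    -- Centres outside the enlarged ball contribute nothing.
    _ ≤ ∫⁻ z, (Metric.closedBall y (D + r / 2)).indicator 1 z := by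
        refine lintegral_mono fun z => ?_
        by_cases hz : z ∈ Metric.closedBall y (D + r / 2)
        · rw [indicator_of_mem hz]
          refine le_trans ?_ (nat_mul_mul_one_sub_pow_le_one n
            (prob_le_one (μ := μ) (s := Metric.closedBall z (r / 2))))
          gcongr
          exact inter_subset_right
        · have : A ∩ Metric.closedBall z (r / 2) = ∅ := by
            refine eq_empty_of_forall_notMem fun x hx => hz ?_
            have h1 := Metric.mem_closedBall.1 hx.1
            have h2 := Metric.mem_closedBall'.1 hx.2
            have h3 := dist_triangle z x y
            exact Metric.mem_closedBall.2 (by linarith)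
          simp [this]
    _ = _ := by rw [lintegral_indicator_one measurableSet_closedBall]

theorem isolProb_le_add (hd : 0 < d) {n : ℕ} (hn : 0 < n) (y : E d) {D r : ℝ} (hD : 0 ≤ D)
    (hr : 0 < r) :
    isolProb μ n r ≤ μ (Metric.closedBall y D)ᶜ +
      ENNReal.ofReal ((D + r / 2) ^ d / (n * (r / 2) ^ d)) := by
  have hV := unitBallVol_pos d
  have hn' : (0 : ℝ) < n := by exact_mod_cast hn
  rw [isolProb, ← lintegral_add_compl _ (measurableSet_closedBall (x := y) (ε := D)), add_comm]
  gcongr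
  · calc _ ≤ ∫⁻ x in (Metric.closedBall y D)ᶜ, 1 ∂μ :=
          lintegral_mono fun x => pow_le_one₀ (zero_le) tsub_le_self
      _ = _ := by simp
  · have h := setLIntegral_one_sub_measure_closedBall_pow_le μ n y D r
    rw [volume_closedBall_eq hd _ (by positivity), volume_closedBall_eq hd _ (by positivity),
      ← ENNReal.ofReal_natCast n, ← mul_assoc, ← ENNReal.ofReal_mul hn'.le, mul_comm,
      ← ENNReal.le_div_iff_mul_le (Or.inl ?_) (Or.inl ENNReal.ofReal_ne_top),
      ← ENNReal.ofReal_div_of_pos (by positivity)] at h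
    · refine h.trans (ENNReal.ofReal_le_ofReal (le_of_eq ?_))
      field_simp
    · exact (ENNReal.ofReal_pos.2 (by positivity)).ne'

end

/-! ### Nearest neighbour distances and the mean of the estimate. -/

theorem lt_nnDist_iff {d n : ℕ} (hn : 0 < n) (x : Fin (n + 1) → E d) (i : Fin (n + 1)) (r : ℝ) :
    r < nnDist x i ↔ ∀ k : Fin n, r < dist (x (i.succAbove k)) (x i) := by
  have : Nonempty {j : Fin (n + 1) // j ≠ i} :=
    ⟨⟨i.succAbove ⟨0, hn⟩, Fin.succAbove_ne _ _⟩⟩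
  unfold nnDist
  constructor
  · intro h k
    rw [dist_comm]
    exact h.trans_le (ciInf_le (Finite.bddBelow_range _)
      (⟨i.succAbove k, Fin.succAbove_ne _ _⟩ : {j : Fin (n + 1) // j ≠ i}))
  · intro h
    obtain ⟨⟨j, hj⟩, hj'⟩ := exists_eq_ciInf_of_finite
      (f := fun j : {j : Fin (n + 1) // j ≠ i} => dist (x i) (x j))
    rw [← hj']
    obtain ⟨k, rfl⟩ := Fin.exists_succAbove_eq hj
    simpa [dist_comm] using h k

theorem measurable_nnDist {d n : ℕ} (i : Fin n) :
    Measurable fun x : Fin n → E d => nnDist x i :=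
  Measurable.iInf fun j => by fun_prop

/-- Conditioning on the `i`-th point leaves `n` independent points, each of which must avoid the
same ball. -/
theorem pi_lt_nnDist {d n : ℕ} (hn : 0 < n) (μ : Measure (E d)) [IsProbabilityMeasure μ]
    (i : Fin (n + 1)) (r : ℝ) :
    Measure.pi (fun _ : Fin (n + 1) => μ) {x | r < nnDist x i} = isolProb μ n r := by
  have hmp := measurePreserving_piFinSuccAbove (fun _ : Fin (n + 1) => μ) i
  set S : Set (E d × (Fin n → E d)) := {p | ∀ k, r < dist (p.2 k) p.1}
  have hS : MeasurableSet S := by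
    have : S = ⋂ k, {p | r < dist (p.2 k) p.1} := by ext; simp [S]
    rw [this]
    exact MeasurableSet.iInter fun k => measurableSet_lt measurable_const (by fun_prop)
  have hpre : {x : Fin (n + 1) → E d | r < nnDist x i} =
      MeasurableEquiv.piFinSuccAbove (fun _ => E d) i ⁻¹' S := by
    ext x
    exact lt_nnDist_iff hn x i r
  rw [hpre, hmp.measure_preimage hS.nullMeasurableSet, Measure.prod_apply hS, isolProb]
  refine lintegral_congr fun x => ?_
  have hx : Prod.mk x ⁻¹' S = Set.univ.pi fun _ : Fin n => (Metric.closedBall x r)ᶜ := by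
    ext y
    simp [S]
  rw [hx, Measure.pi_pi]
  simp [prob_compl_eq_one_sub measurableSet_closedBall]

/-- The radius `r` of the balls of volume `exp t / n`. -/
noncomputable def nnRadius (d n : ℕ) (t : ℝ) : ℝ :=
  Real.exp ((t - Real.log (n * unitBallVol d)) / d)

theorem nnRadius_pos (d n : ℕ) (t : ℝ) : 0 < nnRadius d n t := Real.exp_pos _

theorem nnRadius_pow {d n : ℕ} (hd : 0 < d) (hn : 0 < n) (t : ℝ) :
    nnRadius d n t ^ d = Real.exp t / (n * unitBallVol d) := by
  have hV := unitBallVol_pos d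
  have hn' : (0 : ℝ) < n := by exact_mod_cast hn
  have hd' : (d : ℝ) ≠ 0 := by exact_mod_cast hd.ne'
  rw [nnRadius, ← Real.exp_nat_mul, mul_div_cancel₀ _ hd', Real.exp_sub,
    Real.exp_log (by positivity)]

theorem nnRadius_pow_mul {d n : ℕ} (hd : 0 < d) (hn : 0 < n) (t : ℝ) :
    nnRadius d n t ^ d * unitBallVol d = Real.exp t / n := by
  have hV := unitBallVol_pos d
  rw [nnRadius_pow hd hn]
  field_simp

theorem measurable_nnRadius (d n : ℕ) : Measurable (nnRadius d n) := by
  unfold nnRadius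
  fun_prop

theorem tendsto_nnRadius {d : ℕ} (hd : 0 < d) (t : ℝ) :
    Tendsto (fun n => nnRadius d n t) atTop (𝓝[>] 0) := by
  refine tendsto_nhdsWithin_iff.2 ⟨?_, Eventually.of_forall fun n => nnRadius_pos d n t⟩
  refine Real.tendsto_exp_atBot.comp ?_
  refine Tendsto.atBot_div_const (by exact_mod_cast hd) ?_
  refine tendsto_atBot_add_const_left _ t (tendsto_neg_atTop_atBot.comp ?_)
  exact Real.tendsto_log_atTop.comp
    (tendsto_natCast_atTop_atTop.atTop_mul_const (unitBallVol_pos d))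

section

variable {d n : ℕ} (μ : Measure (E d)) [IsProbabilityMeasure μ] [NullSingletonClass μ]

/-- Almost surely, then, the logarithms in the estimate never take the default value `Real.log 0 =
0`. -/
theorem ae_pi_nnDist_pos (hn : 0 < n) :
    ∀ᵐ x ∂Measure.pi fun _ : Fin (n + 1) => μ, ∀ i, 0 < nnDist x i := by
  rw [ae_all_iff]
  intro i
  refine (mem_ae_iff_prob_eq_one (measurableSet_lt measurable_const (measurable_nnDist i))).2 ?_
  rw [pi_lt_nnDist hn, isolProb_zero_radius]

theorem estimate_eq_of_nnDist_pos (x : Fin (n + 1) → E d) (hn : 0 < n)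
    (hx : ∀ i, 0 < nnDist x i) :
    estimate x = (1 / ((n : ℝ) + 1)) *
      ∑ i, (Real.log (n * unitBallVol d) + d * Real.log (nnDist x i)) + eulerConst := by
  have hn' : (0 : ℝ) < n := by exact_mod_cast hn
  rw [estimate, meanDist, Real.log_rpow (Finset.prod_pos fun i _ => hx i),
    Real.log_prod (fun i _ => (hx i).ne'), Finset.sum_add_distrib, ← Finset.mul_sum,
    Real.log_mul hn'.ne' (unitBallVol_pos d).ne']
  simp only [Nat.cast_add, Nat.cast_one, Finset.sum_const, Finset.card_univ, Fintype.card_fin,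
    nsmul_eq_mul, add_sub_cancel_right]
  field_simp
  ring

/-- The summands are dependent but share one tail, so linearity of the expectation suffices. -/
theorem integral_estimate_pi (hd : 0 < d) (hn : 0 < n)
    (hpos : ∫⁻ t in Ioi 0, isolProb μ n (nnRadius d n t) ≠ ⊤)
    (hneg : ∫⁻ t in Ioi 0, (1 - isolProb μ n (nnRadius d n (-t))) ≠ ⊤) :
    Integrable (fun x : Fin (n + 1) → E d => estimate x) (Measure.pi fun _ => μ) ∧
      ∫ x, estimate x ∂(Measure.pi fun _ : Fin (n + 1) => μ) =
        (∫⁻ t in Ioi 0, isolProb μ n (nnRadius d n t)).toReal -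
        (∫⁻ t in Ioi 0, (1 - isolProb μ n (nnRadius d n (-t)))).toReal + eulerConst := by
  have hd' : (0 : ℝ) < d := by exact_mod_cast hd
  have hn' : (0 : ℝ) < n := by exact_mod_cast hn
  have hae := ae_pi_nnDist_pos (n := n) μ hn
  set ν := Measure.pi fun _ : Fin (n + 1) => μ
  set Z : Fin (n + 1) → (Fin (n + 1) → E d) → ℝ := fun i x =>
    Real.log (n * unitBallVol d) + d * Real.log (nnDist x i)
  have hZ : ∀ i, Measurable (Z i) := fun i =>
    ((Real.measurable_log.comp (measurable_nnDist i)).const_mul _).const_add _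
  have htail : ∀ i t, ν {x | t < Z i x} = isolProb μ n (nnRadius d n t) := by
    intro i t
    rw [← pi_lt_nnDist hn μ i]
    apply measure_congr
    filter_upwards [hae] with x hx
    apply propext
    change t < Real.log _ + d * Real.log (nnDist x i) ↔ Real.exp _ < nnDist x i
    rw [← Real.lt_log_iff_exp_lt (hx i), div_lt_iff₀ hd', sub_lt_iff_lt_add',
      mul_comm (Real.log (nnDist x i))]
  have hint := fun i => integrable_and_integral_eq_of_tail (hZ i) (htail i) hpos hneg
  have heq : (fun x => estimate x) =ᵐ[ν] fun x =>
      (1 / ((n : ℝ) + 1)) * ∑ i, Z i x + eulerConst := by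
    filter_upwards [hae] with x hx
    exact estimate_eq_of_nnDist_pos x hn hx
  have hsum : Integrable (fun x => ∑ i, Z i x) ν := integrable_finsetSum _ fun i _ => (hint i).1
  refine ⟨((hsum.const_mul _).add (integrable_const _)).congr heq.symm, ?_⟩
  rw [integral_congr_ae heq, integral_add (hsum.const_mul _) (integrable_const _),
    integral_const_mul, integral_finsetSum _ fun i _ => (hint i).1]
  simp only [(hint _).2, Finset.sum_const, Finset.card_univ, Fintype.card_fin, nsmul_eq_mul,
    integral_const, probReal_univ, one_smul, Nat.cast_add, Nat.cast_one]
  field_simp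

end

/-! ### Pointwise limit of the tail and domination of the lower tail. -/

section

variable {d : ℕ} {f : E d → ℝ}

/-- Differentiation of measures gives n times the ball mass → f(x) e^t, since the ball has volume
e^t / n; then (1 + a_n)^n → e^a when n a_n → a. -/
theorem ae_tendsto_isol_pow (hd : 0 < d) (hf : IsProbDensity f) :
    ∀ᵐ x ∂law f, ∀ t, Tendsto
      (fun n : ℕ => (1 - law f (Metric.closedBall x (nnRadius d n t))) ^ n) atTop
      (𝓝 (ENNReal.ofReal (Real.exp (-(f x * Real.exp t))))) := by
  have := isProbabilityMeasure_law hf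
  have h1 := (law_absolutelyContinuous f).ae_le
    (Besicovitch.ae_tendsto_rnDeriv (law f) (volume : Measure (E d)))
  have h2 := (law_absolutelyContinuous f).ae_le
    (Measure.rnDeriv_withDensity (volume : Measure (E d)) hf.measurable.ennreal_ofReal)
  filter_upwards [h1, h2] with x hx hx2 t
  rw [show (law f).rnDeriv volume x = ENNReal.ofReal (f x) from hx2] at hx
  set p : ℕ → ℝ≥0∞ := fun n => law f (Metric.closedBall x (nnRadius d n t))
  have hr := (ENNReal.tendsto_toReal ENNReal.ofReal_ne_top).comp (hx.comp (tendsto_nnRadius hd t))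
  rw [ENNReal.toReal_ofReal (hf.nonneg x)] at hr
  have hg : Tendsto (fun n : ℕ => (n : ℝ) * -(p n).toReal) atTop (𝓝 (-(f x * Real.exp t))) := by
    refine ((hr.mul_const (Real.exp t)).neg).congr' ?_
    filter_upwards [eventually_gt_atTop 0] with n hn
    have hn' : (0 : ℝ) < n := by exact_mod_cast hn
    simp only [Function.comp_apply, volume_closedBall_eq hd _ (nnRadius_pos d n t).le,
      nnRadius_pow_mul hd hn, ENNReal.toReal_div]
    rw [ENNReal.toReal_ofReal (by positivity)]
    change -((p n).toReal / (Real.exp t / n) * Real.exp t) = _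
    field_simp
  have := ENNReal.tendsto_ofReal (Real.tendsto_one_add_pow_exp_of_tendsto hg)
  refine this.congr fun n => ?_
  have hp1 : p n ≤ 1 := prob_le_one
  have hp : p n ≠ ⊤ := ne_top_of_le_ne_top ENNReal.one_ne_top hp1
  have hpr : (p n).toReal ≤ 1 := ENNReal.toReal_le_of_le_ofReal one_pos.le (by simpa using hp1)
  rw [← sub_eq_add_neg, ENNReal.ofReal_pow (by linarith), ENNReal.ofReal_sub _ (by positivity),
    ENNReal.ofReal_one, ENNReal.ofReal_toReal hp]

theorem tendsto_isolProb_nnRadius (hd : 0 < d) (hf : IsProbDensity f) (t : ℝ) :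
    Tendsto (fun n => isolProb (law f) n (nnRadius d n t)) atTop
      (𝓝 (∫⁻ x, ENNReal.ofReal (Real.exp (-(f x * Real.exp t))) ∂law f)) := by
  have := isProbabilityMeasure_law hf
  refine tendsto_lintegral_of_dominated_convergence (fun _ => 1)
    (fun n => measurable_one_sub_measure_closedBall_pow _ n _)
    (fun n => ae_of_all _ fun x => pow_le_one₀ (zero_le) tsub_le_self) (by simp) ?_
  filter_upwards [ae_tendsto_isol_pow hd hf] with x hx using hx t

/-- The left side is at most 1 and, by Bernoulli, at most n m. Whichever side of 1 contains y, one
of these bounds is below y^δ. -/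
theorem one_sub_pow_le_rpow (n : ℕ) {m y : ℝ≥0∞} (hm : m ≤ 1) (hy : n * m ≤ y) {δ : ℝ}
    (hδ : 0 < δ) (hδ1 : δ ≤ 1) : 1 - (1 - m) ^ n ≤ y ^ δ := by
  rcases le_total 1 y with h | h
  · exact tsub_le_self.trans (ENNReal.one_le_rpow h hδ)
  · have hb : 1 - (1 - m) ^ n ≤ n * m := by
      obtain ⟨a, ha0, rfl⟩ : ∃ a : ℝ, 0 ≤ a ∧ m = ENNReal.ofReal a :=
        ⟨m.toReal, ENNReal.toReal_nonneg,
          (ENNReal.ofReal_toReal (ne_top_of_le_ne_top ENNReal.one_ne_top hm)).symm⟩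
      have ha1 : a ≤ 1 := ENNReal.ofReal_le_one.1 hm
      have ha2 : 0 ≤ (1 - a) ^ n := pow_nonneg (by linarith) _
      rw [← ENNReal.ofReal_one, ← ENNReal.ofReal_sub _ ha0, ← ENNReal.ofReal_pow (by linarith),
        ← ENNReal.ofReal_sub _ ha2, ← ENNReal.ofReal_natCast, ← ENNReal.ofReal_mul (by positivity)]
      apply ENNReal.ofReal_le_ofReal
      have := one_add_mul_le_pow (a := -a) (by linarith) n
      rw [← sub_eq_add_neg] at this
      linarith
    calc _ ≤ y ^ (1 : ℝ) := by rw [ENNReal.rpow_one]; exact hb.trans hy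
      _ ≤ y ^ δ := ENNReal.rpow_le_rpow_of_exponent_ge h hδ1

/-- The ball has volume e^(-t) / n and radius at most R, so n times its mass is at most `maxAvg f x
R` times e^(-t). Raising this to the power δ ≤ 1 leaves a quantity controlled by `Q`. -/
theorem one_sub_isolProb_nnRadius_le (hd : 0 < d) (hf : IsProbDensity f) {ε R : ℝ} (hε : 0 < ε)
    {n : ℕ} (hn : 0 < n) {t : ℝ} (ht : nnRadius d n (-t) ≤ R) :
    1 - isolProb (law f) n (nnRadius d n (-t)) ≤
      (1 + Q f ε R) * ENNReal.ofReal (Real.exp (-(min ε 1 * t))) := by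
  have := isProbabilityMeasure_law hf
  have hV := unitBallVol_pos d
  have hn' : (0 : ℝ) < n := by exact_mod_cast hn
  set r := nnRadius d n (-t)
  set δ := min ε 1
  have hr : 0 < r := nnRadius_pos _ _ _
  have hδ : 0 < δ := lt_min hε one_pos
  have hnp : ∀ x, n * law f (Metric.closedBall x r) ≤
      maxAvg f x R * ENNReal.ofReal (Real.exp (-t)) := by
    intro x
    have h1 : ballAvg f x r ≤ maxAvg f x R :=
      le_iSup₂ (f := fun r (_ : r ∈ Ioc (0 : ℝ) R) => ballAvg f x r) r ⟨hr, ht⟩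
    have h2 : law f (Metric.closedBall x r) = ballAvg f x r * ENNReal.ofReal (Real.exp (-t) / n) := by
      rw [ballAvg, nnRadius_pow_mul hd hn, law_apply f measurableSet_closedBall,
        ENNReal.div_mul_cancel (ENNReal.ofReal_pos.2 (by positivity)).ne' ENNReal.ofReal_ne_top]
    rw [h2, mul_left_comm, ← ENNReal.ofReal_natCast n, ← ENNReal.ofReal_mul hn'.le,
      mul_div_cancel₀ _ hn'.ne']
    gcongr
  have hmeas := measurable_one_sub_measure_closedBall_pow (law f) n r
  have hfin : ∫⁻ x, (1 - law f (Metric.closedBall x r)) ^ n ∂law f ≠ ⊤ :=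
    ne_top_of_le_ne_top ENNReal.one_ne_top (isolProb_le_one (law f) n r)
  have h1 : 1 - isolProb (law f) n r =
      ∫⁻ x, (1 - (1 - law f (Metric.closedBall x r)) ^ n) ∂law f := by
    rw [lintegral_sub hmeas hfin (ae_of_all _ fun x => pow_le_one₀ (zero_le) tsub_le_self)]
    simp [isolProb]
  rw [h1]
  calc _ ≤ ∫⁻ x, (1 + maxAvg f x R ^ ε) * ENNReal.ofReal (Real.exp (-(δ * t))) ∂law f := by
        refine lintegral_mono fun x => ?_
        refine (one_sub_pow_le_rpow n prob_le_one (hnp x) hδ (min_le_right _ _)).trans ?_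
        rw [ENNReal.mul_rpow_of_nonneg _ _ hδ.le, ENNReal.ofReal_rpow_of_pos (Real.exp_pos _),
          ← Real.exp_mul, show -t * δ = -(δ * t) by ring]
        gcongr
        rcases le_total 1 (maxAvg f x R) with h | h
        · exact (ENNReal.rpow_le_rpow_of_exponent_le h (min_le_left _ _)).trans le_add_self
        · exact (ENNReal.rpow_le_one h hδ.le).trans le_self_add
    _ = _ := by
        rw [lintegral_mul_const' _ _ ENNReal.ofReal_ne_top, lintegral_add_left measurable_const,
          lintegral_law hf (fun x => maxAvg f x R ^ ε)]
        simp [Q]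

end

/-! ### Domination of the upper tail. -/

section

variable {d : ℕ} (μ : Measure (E d))

theorem nnRadius_add_log (d n : ℕ) (t : ℝ) :
    nnRadius d n (t + Real.log (n * unitBallVol d)) = Real.exp (t / d) := by
  rw [nnRadius, add_sub_cancel_right]

theorem nnRadius_le_one (n : ℕ) {t : ℝ} (ht : t ≤ Real.log (n * unitBallVol d)) :
    nnRadius d n t ≤ 1 :=
  Real.exp_le_one_iff.2 (div_nonpos_of_nonpos_of_nonneg (by linarith) (by positivity))

/-- An integrable bound of the isolation probabilities at the radii `nnRadius d n t ≤ 1`. -/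
noncomputable def isolBound (y : E d) (t : ℝ) : ℝ≥0∞ :=
  μ (Metric.closedBall y (Real.exp (t / (2 * d))))ᶜ +
    ENNReal.ofReal (4 ^ d * unitBallVol d) * ENNReal.ofReal (Real.exp (-(1 / 2 * t)))

/-- Truncation at distance `exp (t / (2 d))` from `y` balances the two terms of `isolProb_le_add`. -/
theorem isolProb_nnRadius_le_isolBound [IsProbabilityMeasure μ] (hd : 0 < d) {n : ℕ} (hn : 0 < n) (y : E d) {t : ℝ}
    (ht0 : 0 ≤ t) (ht : t ≤ Real.log (n * unitBallVol d)) :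
    isolProb μ n (nnRadius d n t) ≤ isolBound μ y t := by
  have hV := unitBallVol_pos d
  have hn' : (0 : ℝ) < n := by exact_mod_cast hn
  have hd' : (0 : ℝ) < d := by exact_mod_cast hd
  set r := nnRadius d n t
  set D := Real.exp (t / (2 * d))
  have hr : 0 < r := nnRadius_pos _ _ _
  have hr1 : r ≤ 1 := nnRadius_le_one n ht
  have hD : 1 ≤ D := Real.one_le_exp (by positivity)
  refine (isolProb_le_add μ hd hn y (by positivity : 0 ≤ D) hr).trans ?_
  unfold isolBound
  gcongr
  rw [← ENNReal.ofReal_mul (by positivity)]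
  apply ENNReal.ofReal_le_ofReal
  have hDd : D ^ d = Real.exp (t / 2) := by
    rw [← Real.exp_nat_mul]; congr 1; field_simp
  have hexp : Real.exp t = Real.exp (t / 2) * Real.exp (t / 2) := by
    rw [← Real.exp_add]; congr 1; ring
  have hneg : Real.exp (-(1 / 2 * t)) = 1 / Real.exp (t / 2) := by
    rw [show -(1 / 2 * t) = -(t / 2) by ring, Real.exp_neg, one_div]
  -- Here r / 2 ≤ D because r ≤ 1 ≤ D. The factor 4^d collects 2^d from doubling D and 2^d from
  -- halving r.
  calc (D + r / 2) ^ d / (n * (r / 2) ^ d) ≤ (2 * D) ^ d / (n * (r / 2) ^ d) := by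
        gcongr; linarith
    _ = 4 ^ d * unitBallVol d * Real.exp (-(1 / 2 * t)) := by
        rw [mul_pow, hDd, div_pow, nnRadius_pow hd hn, hneg, hexp,
          show (4 : ℝ) = 2 * 2 by norm_num, mul_pow]
        field_simp

/-- The first term is the tail of 2d log dist(y, x), whose positive part has finite mean; the second
decays exponentially. -/
theorem lintegral_isolBound_ne_top (hd : 0 < d) {y : E d}
    (hy : ∫⁻ x, ENNReal.ofReal (Real.log (dist y x)) ∂μ ≠ ⊤) :
    ∫⁻ t in Ioi (0 : ℝ), isolBound μ y t ≠ ⊤ := by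
  have hd' : (0 : ℝ) < 2 * d := by positivity
  have hm : Measurable fun x => Real.log (dist y x) := Real.measurable_log.comp (by fun_prop)
  unfold isolBound
  rw [lintegral_add_right _ (by fun_prop), lintegral_const_mul' _ _ ENNReal.ofReal_ne_top]
  refine ENNReal.add_ne_top.2 ⟨?_, ENNReal.mul_ne_top ENNReal.ofReal_ne_top
    (lintegral_exp_neg_mul_Ioi_ne_top (by norm_num))⟩
  have h := lintegral_ofReal_eq_lintegral_meas_lt μ (hm.const_mul (2 * d))
  simp_rw [ENNReal.ofReal_mul hd'.le] at h
  rw [lintegral_const_mul' _ _ ENNReal.ofReal_ne_top] at h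
  refine ne_of_eq_of_ne ?_ (ENNReal.mul_ne_top (ENNReal.ofReal_ne_top (r := 2 * d)) hy)
  rw [h]
  refine setLIntegral_congr_fun measurableSet_Ioi fun t ht => ?_
  have ht : 0 < t := ht
  congr 1
  ext x
  simp only [mem_ofPred_eq, mem_compl_iff, Metric.mem_closedBall', not_le]
  rcases (dist_nonneg (x := y) (y := x)).eq_or_lt with h | h
  · rw [← h, Real.log_zero, mul_zero]
    exact iff_of_false (not_lt.2 (Real.exp_pos _).le) (not_lt.2 ht.le)
  · rw [← Real.lt_log_iff_exp_lt h, div_lt_iff₀ hd', mul_comm]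

theorem exists_lintegral_log_dist_ne_top [IsProbabilityMeasure μ]
    (hlog : ∫⁻ x, ∫⁻ y, ENNReal.ofReal (Real.log (dist x y)) ∂μ ∂μ ≠ ⊤) :
    ∃ y : E d, ∫⁻ x, ENNReal.ofReal (Real.log (dist y x)) ∂μ ≠ ⊤ := by
  have hm : Measurable fun p : E d × E d => ENNReal.ofReal (Real.log (dist p.1 p.2)) :=
    (Real.measurable_log.comp (by fun_prop)).ennreal_ofReal
  obtain ⟨y, hy⟩ := (ae_lt_top hm.lintegral_prod_right' hlog).exists
  exact ⟨y, hy.ne⟩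

/-- Translating t by log(n V_d) makes the radius e^(t / d), independent of `n`. -/
theorem lintegral_isolProb_nnRadius_far_le (n : ℕ) :
    ∫⁻ t in Ioi (0 : ℝ), (Ioi (Real.log (n * unitBallVol d))).indicator
        (fun t => isolProb μ n (nnRadius d n t)) t ≤
      ∫⁻ t in Ioi (0 : ℝ), isolProb μ n (Real.exp (t / d)) := by
  set L := Real.log (n * unitBallVol d) with hL
  calc _ ≤ ∫⁻ t, (Ioi L).indicator (fun t => isolProb μ n (nnRadius d n t)) t :=
        setLIntegral_le_lintegral _ _
    _ = ∫⁻ t, (Ioi L).indicator (fun t => isolProb μ n (nnRadius d n t)) (t + L) :=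
        (lintegral_add_right_eq_self _ L).symm
    _ = ∫⁻ t in Ioi (0 : ℝ), isolProb μ n (Real.exp (t / d)) := by
        rw [← lintegral_indicator measurableSet_Ioi]
        refine lintegral_congr fun t => ?_
        simp only [indicator, mem_Ioi, lt_add_iff_pos_left]
        split_ifs
        · rw [hL, nnRadius_add_log]
        · rfl

theorem tendsto_lintegral_isolProb_far [IsProbabilityMeasure μ] (hd : 0 < d)
    (hlog : ∫⁻ x, ∫⁻ y, ENNReal.ofReal (Real.log (dist x y)) ∂μ ∂μ ≠ ⊤) :
    Tendsto (fun n => ∫⁻ t in Ioi (0 : ℝ), isolProb μ n (Real.exp (t / d))) atTop (𝓝 0) := by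
  have h : Tendsto (fun n => ∫⁻ t in Ioi (0 : ℝ), isolProb μ n (Real.exp (t / d))) atTop
      (𝓝 (∫⁻ _ in Ioi (0 : ℝ), 0)) := by
    refine tendsto_lintegral_filter_of_dominated_convergence
      (fun t => isolProb μ 1 (Real.exp (t / d)))
      (Eventually.of_forall fun n => (measurable_isolProb μ n).comp (by fun_prop)) ?_ ?_ ?_
    · filter_upwards [eventually_ge_atTop 1] with n hn
      exact ae_of_all _ fun t => isolProb_anti_card μ hn _
    · rw [lintegral_isolProb_one μ hd]
      exact ENNReal.mul_ne_top (ENNReal.natCast_ne_top d) hlog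
    · exact ae_of_all _ fun t => tendsto_isolProb_zero μ (Real.exp_pos _)
  simpa using h

theorem lintegral_isolProb_nnRadius_split [IsProbabilityMeasure μ] (n : ℕ) :
    ∫⁻ t in Ioi (0 : ℝ), isolProb μ n (nnRadius d n t) =
      (∫⁻ t in Ioi (0 : ℝ), (Iic (Real.log (n * unitBallVol d))).indicator
        (fun t => isolProb μ n (nnRadius d n t)) t) +
      ∫⁻ t in Ioi (0 : ℝ), (Ioi (Real.log (n * unitBallVol d))).indicator
        (fun t => isolProb μ n (nnRadius d n t)) t := by
  have hm : Measurable fun t => isolProb μ n (nnRadius d n t) :=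
    (measurable_isolProb μ n).comp (measurable_nnRadius d n)
  rw [← lintegral_add_left (hm.indicator measurableSet_Iic)]
  refine lintegral_congr fun t => ?_
  rw [← compl_Iic]
  exact (indicator_self_add_compl_apply (Iic (Real.log (n * unitBallVol d)))
    (fun t => isolProb μ n (nnRadius d n t)) t).symm

theorem indicator_isolProb_le_isolBound [IsProbabilityMeasure μ] (hd : 0 < d) {n : ℕ} (hn : 0 < n) (y : E d) :
    ∀ᵐ t ∂volume.restrict (Ioi (0 : ℝ)), (Iic (Real.log (n * unitBallVol d))).indicator
      (fun t => isolProb μ n (nnRadius d n t)) t ≤ isolBound μ y t := by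
  filter_upwards [ae_restrict_mem measurableSet_Ioi] with t ht
  by_cases h : t ≤ Real.log (n * unitBallVol d)
  · rw [indicator_of_mem (show t ∈ Iic _ from h)]
    exact isolProb_nnRadius_le_isolBound μ hd hn y (le_of_lt ht) h
  · rw [indicator_of_notMem (show t ∉ Iic _ from h)]
    exact zero_le

theorem lintegral_isolProb_nnRadius_ne_top [IsProbabilityMeasure μ] (hd : 0 < d)
    (hlog : ∫⁻ x, ∫⁻ y, ENNReal.ofReal (Real.log (dist x y)) ∂μ ∂μ ≠ ⊤) {n : ℕ} (hn : 0 < n) :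
    ∫⁻ t in Ioi (0 : ℝ), isolProb μ n (nnRadius d n t) ≠ ⊤ := by
  obtain ⟨y, hy⟩ := exists_lintegral_log_dist_ne_top μ hlog
  rw [lintegral_isolProb_nnRadius_split]
  refine ENNReal.add_ne_top.2 ⟨?_, ?_⟩
  · exact ne_top_of_le_ne_top (lintegral_isolBound_ne_top μ hd hy)
      (lintegral_mono_ae (indicator_isolProb_le_isolBound μ hd hn y))
  · refine ne_top_of_le_ne_top ?_ ((lintegral_isolProb_nnRadius_far_le μ n).trans
      (lintegral_mono fun t => isolProb_anti_card μ hn _))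
    rw [lintegral_isolProb_one μ hd]
    exact ENNReal.mul_ne_top (ENNReal.natCast_ne_top d) hlog

end

/-! ### Passage to the limit and asymptotic unbiasedness. -/

section

variable {d : ℕ} {f : E d → ℝ}

theorem tendsto_lintegral_isolProb_pos (hd : 0 < d) (hf : IsProbDensity f)
    (hlog : ∫⁻ x, ∫⁻ y, ENNReal.ofReal (Real.log (dist x y)) ∂law f ∂law f ≠ ⊤) :
    Tendsto (fun n => ∫⁻ t in Ioi (0 : ℝ), isolProb (law f) n (nnRadius d n t)) atTop
        (𝓝 (∫⁻ t in Ioi (0 : ℝ),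
          ∫⁻ x, ENNReal.ofReal (Real.exp (-(f x * Real.exp t))) ∂law f)) ∧
      ∫⁻ t in Ioi (0 : ℝ),
        ∫⁻ x, ENNReal.ofReal (Real.exp (-(f x * Real.exp t))) ∂law f ≠ ⊤ := by
  have := isProbabilityMeasure_law hf
  obtain ⟨y, hy⟩ := exists_lintegral_log_dist_ne_top _ hlog
  have hb := lintegral_isolBound_ne_top (law f) hd hy
  have hL : Tendsto (fun n : ℕ => Real.log (n * unitBallVol d)) atTop atTop :=
    Real.tendsto_log_atTop.comp
      (tendsto_natCast_atTop_atTop.atTop_mul_const (unitBallVol_pos d))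
  have hle : ∀ᶠ n : ℕ in atTop, ∀ᵐ t ∂volume.restrict (Ioi (0 : ℝ)),
      (Iic (Real.log (n * unitBallVol d))).indicator
        (fun t => isolProb (law f) n (nnRadius d n t)) t ≤ isolBound (law f) y t := by
    filter_upwards [eventually_gt_atTop 0] with n hn
    exact indicator_isolProb_le_isolBound (law f) hd hn y
  have h1 : Tendsto (fun n : ℕ => ∫⁻ t in Ioi (0 : ℝ),
      (Iic (Real.log (n * unitBallVol d))).indicator
        (fun t => isolProb (law f) n (nnRadius d n t)) t) atTop
      (𝓝 (∫⁻ t in Ioi (0 : ℝ),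
        ∫⁻ x, ENNReal.ofReal (Real.exp (-(f x * Real.exp t))) ∂law f)) := by
    refine tendsto_lintegral_filter_of_dominated_convergence _
      (Eventually.of_forall fun n => ((measurable_isolProb _ n).comp
        (measurable_nnRadius d n)).indicator measurableSet_Iic) hle hb ?_
    refine ae_of_all _ fun t => (tendsto_isolProb_nnRadius hd hf t).congr' ?_
    filter_upwards [hL.eventually_ge_atTop t] with n hn
    rw [indicator_of_mem (show t ∈ Iic _ from hn)]
  have h2 := tendsto_of_tendsto_of_tendsto_of_le_of_le tendsto_const_nhds
    (tendsto_lintegral_isolProb_far (law f) hd hlog) (fun n => zero_le)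
    (lintegral_isolProb_nnRadius_far_le (law f))
  refine ⟨?_, ?_⟩
  · have := h1.add h2
    rw [add_zero] at this
    exact this.congr fun n => (lintegral_isolProb_nnRadius_split (law f) n).symm
  · refine ne_top_of_le_ne_top hb (le_of_tendsto h1 ?_)
    filter_upwards [hle] with n hn using lintegral_mono_ae hn

theorem lintegral_const_mul_exp_ne_top {C : ℝ≥0∞} (hC : C ≠ ⊤) {δ : ℝ} (hδ : 0 < δ) :
    ∫⁻ t in Ioi (0 : ℝ), C * ENNReal.ofReal (Real.exp (-(δ * t))) ≠ ⊤ := by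
  rw [lintegral_const_mul' _ _ hC]
  exact ENNReal.mul_ne_top hC (lintegral_exp_neg_mul_Ioi_ne_top hδ)

theorem nnRadius_mono (d n : ℕ) : Monotone (nnRadius d n) := fun s t h => by
  unfold nnRadius
  gcongr

/-- For fixed `n` the radius may exceed R for small t; the trivial bound 1 serves on that bounded
range. -/
theorem lintegral_one_sub_isolProb_ne_top (hd : 0 < d) (hf : IsProbDensity f) (hQ : FiniteQ f)
    {n : ℕ} (hn : 0 < n) :
    ∫⁻ t in Ioi (0 : ℝ), (1 - isolProb (law f) n (nnRadius d n (-t))) ≠ ⊤ := by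
  obtain ⟨ε, R, hε, hR, hQ⟩ := hQ
  obtain ⟨s, hs⟩ : ∃ s : ℝ, nnRadius d n (-s) ≤ R := by
    have hd' : (0 : ℝ) < d := by exact_mod_cast hd
    refine ⟨-(d * Real.log R + Real.log (n * unitBallVol d)), ?_⟩
    rw [neg_neg, nnRadius_add_log, mul_div_cancel_left₀ _ hd'.ne', Real.exp_log hR]
  have h1 : ∫⁻ t in Ioi (0 : ℝ), (Iic s).indicator (1 : ℝ → ℝ≥0∞) t ≠ ⊤ := by
    rw [lintegral_indicator_one measurableSet_Iic, Measure.restrict_apply measurableSet_Iic,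
      Iic_inter_Ioi, Real.volume_Ioc]
    exact ENNReal.ofReal_ne_top
  have h2 := lintegral_const_mul_exp_ne_top
    (ENNReal.add_ne_top.2 ⟨ENNReal.one_ne_top, hQ.ne⟩) (lt_min hε one_pos)
  refine ne_top_of_le_ne_top (ENNReal.add_ne_top.2 ⟨h1, h2⟩) ?_
  rw [← lintegral_add_right _ (by fun_prop)]
  refine lintegral_mono fun t => ?_
  by_cases ht : t ≤ s
  · rw [indicator_of_mem (show t ∈ Iic _ from ht)]
    exact tsub_le_self.trans le_self_add
  · refine (one_sub_isolProb_nnRadius_le hd hf hε hn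
      ((nnRadius_mono d n ?_).trans hs)).trans le_add_self
    linarith [not_le.1 ht]

theorem tendsto_lintegral_isolProb_neg (hd : 0 < d) (hf : IsProbDensity f) (hQ : FiniteQ f) :
    Tendsto (fun n => ∫⁻ t in Ioi (0 : ℝ), (1 - isolProb (law f) n (nnRadius d n (-t)))) atTop
        (𝓝 (∫⁻ t in Ioi (0 : ℝ),
          (1 - ∫⁻ x, ENNReal.ofReal (Real.exp (-(f x * Real.exp (-t)))) ∂law f))) ∧
      ∫⁻ t in Ioi (0 : ℝ),
        (1 - ∫⁻ x, ENNReal.ofReal (Real.exp (-(f x * Real.exp (-t)))) ∂law f) ≠ ⊤ := by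
  obtain ⟨ε, R, hε, hR, hQ⟩ := hQ
  have hb := lintegral_const_mul_exp_ne_top
    (ENNReal.add_ne_top.2 ⟨ENNReal.one_ne_top, hQ.ne⟩) (lt_min hε one_pos)
  have hle : ∀ᶠ n : ℕ in atTop, ∀ᵐ t ∂volume.restrict (Ioi (0 : ℝ)),
      1 - isolProb (law f) n (nnRadius d n (-t)) ≤
        (1 + Q f ε R) * ENNReal.ofReal (Real.exp (-(min ε 1 * t))) := by
    -- Once the radius at t = 0 is at most R, so is the radius at -t for every t > 0.
    have h0 := (tendsto_nhdsWithin_iff.1 (tendsto_nnRadius hd 0)).1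
    filter_upwards [eventually_gt_atTop 0, h0.eventually_le_const hR] with n hn hnR
    filter_upwards [ae_restrict_mem measurableSet_Ioi] with t ht
    refine one_sub_isolProb_nnRadius_le hd hf hε hn ((nnRadius_mono d n ?_).trans hnR)
    exact neg_nonpos.2 (le_of_lt ht)
  have h1 : Tendsto (fun n => ∫⁻ t in Ioi (0 : ℝ),
      (1 - isolProb (law f) n (nnRadius d n (-t)))) atTop
      (𝓝 (∫⁻ t in Ioi (0 : ℝ),
        (1 - ∫⁻ x, ENNReal.ofReal (Real.exp (-(f x * Real.exp (-t)))) ∂law f))) := by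
    refine tendsto_lintegral_filter_of_dominated_convergence _
      (Eventually.of_forall fun n => measurable_const.sub ((measurable_isolProb _ n).comp
        ((measurable_nnRadius d n).comp measurable_neg))) hle hb ?_
    exact ae_of_all _ fun t => ENNReal.Tendsto.sub tendsto_const_nhds
      (tendsto_isolProb_nnRadius hd hf (-t)) (Or.inl ENNReal.one_ne_top)
  refine ⟨h1, ne_top_of_le_ne_top hb (le_of_tendsto h1 ?_)⟩
  filter_upwards [hle] with n hn using lintegral_mono_ae hn

/-- Tonelli exchanges t and x, and the exponential-law identity evaluates the inner difference
wherever f(x) > 0. -/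
theorem integrable_log_and_integral_log (hf : IsProbDensity f)
    (hpos : ∫⁻ t in Ioi (0 : ℝ),
      ∫⁻ x, ENNReal.ofReal (Real.exp (-(f x * Real.exp t))) ∂law f ≠ ⊤)
    (hneg : ∫⁻ t in Ioi (0 : ℝ),
      (1 - ∫⁻ x, ENNReal.ofReal (Real.exp (-(f x * Real.exp (-t)))) ∂law f) ≠ ⊤) :
    Integrable (fun x => Real.log (f x)) (law f) ∧
      (∫⁻ t in Ioi (0 : ℝ),
        ∫⁻ x, ENNReal.ofReal (Real.exp (-(f x * Real.exp t))) ∂law f).toReal -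
      (∫⁻ t in Ioi (0 : ℝ),
        (1 - ∫⁻ x, ENNReal.ofReal (Real.exp (-(f x * Real.exp (-t)))) ∂law f)).toReal =
      -eulerConst - ∫ x, Real.log (f x) ∂law f := by
  have := isProbabilityMeasure_law hf
  have hfm := hf.measurable
  have hsub : ∀ t : ℝ, 1 - ∫⁻ x, ENNReal.ofReal (Real.exp (-(f x * Real.exp (-t)))) ∂law f =
      ∫⁻ x, (1 - ENNReal.ofReal (Real.exp (-(f x * Real.exp (-t))))) ∂law f := by
    intro t
    have hle : ∀ x, ENNReal.ofReal (Real.exp (-(f x * Real.exp (-t)))) ≤ 1 := fun x =>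
      ENNReal.ofReal_le_one.2 (Real.exp_le_one_iff.2 (neg_nonpos.2
        (mul_nonneg (hf.nonneg x) (Real.exp_pos _).le)))
    rw [lintegral_sub (by fun_prop) _ (ae_of_all _ hle)]
    · simp
    · refine ne_top_of_le_ne_top ENNReal.one_ne_top ((lintegral_mono hle).trans ?_)
      simp
  simp_rw [hsub] at hneg ⊢
  rw [lintegral_lintegral_swap (by fun_prop)] at hpos hneg ⊢
  rw [lintegral_lintegral_swap (f := fun (t : ℝ) (x : E d) =>
    1 - ENNReal.ofReal (Real.exp (-(f x * Real.exp (-t))))) (by fun_prop)]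
  set A : E d → ℝ≥0∞ := fun x =>
    ∫⁻ t in Ioi (0 : ℝ), ENNReal.ofReal (Real.exp (-(f x * Real.exp t)))
  set B : E d → ℝ≥0∞ := fun x =>
    ∫⁻ t in Ioi (0 : ℝ), (1 - ENNReal.ofReal (Real.exp (-(f x * Real.exp (-t)))))
  have hA : Measurable A := Measurable.lintegral_prod_right (by fun_prop)
  have hB : Measurable B := Measurable.lintegral_prod_right (by fun_prop)
  have hAi : Integrable (fun x => (A x).toReal) (law f) :=
    integrable_toReal_of_lintegral_ne_top hA.aemeasurable hpos
  have hBi : Integrable (fun x => (B x).toReal) (law f) :=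
    integrable_toReal_of_lintegral_ne_top hB.aemeasurable hneg
  have heq : (fun x => (A x).toReal - (B x).toReal) =ᵐ[law f]
      fun x => -eulerConst - Real.log (f x) := by
    filter_upwards [ae_law_pos hf] with x hx using lintegral_exp_neg_mul_exp_sub hx
  have hi : Integrable (fun x => Real.log (f x)) (law f) := by
    have := (integrable_const (μ := law f) (-eulerConst)).sub ((hAi.sub hBi).congr heq)
    refine this.congr (ae_of_all _ fun x => ?_)
    simp
  refine ⟨hi, ?_⟩
  rw [← integral_toReal hA.aemeasurable (ae_lt_top hA hpos),
    ← integral_toReal hB.aemeasurable (ae_lt_top hB hneg), ← integral_sub hAi hBi,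
    integral_congr_ae heq, integral_sub (integrable_const _) hi]
  simp

/-- Asymptotic unbiasedness holds as soon as `log⁺ dist` has a finite mean under `law f ⊗ law f` and
`Q` is finite: no lower bound for the averages of `f` is required. -/
theorem asympUnbiased_of_lintegral_log_dist {Ω : Type*} [MeasurableSpace Ω] {P : Measure Ω}
    [IsProbabilityMeasure P] (hd : 0 < d) (hf : IsProbDensity f) {X : ℕ → Ω → E d}
    (hX : ∀ i, Measurable (X i)) (hindep : ProbabilityTheory.iIndepFun X P)
    (hlaw : ∀ i, P.map (X i) = law f)
    (hlog : ∫⁻ x, ∫⁻ y, ENNReal.ofReal (Real.log (dist x y)) ∂law f ∂law f ≠ ⊤)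
    (hQ : FiniteQ f) : AsympUnbiased P X f := by
  have := isProbabilityMeasure_law hf
  have : Nonempty (Fin d) := ⟨⟨0, hd⟩⟩
  have : NullSingletonClass (law f) := by unfold law; infer_instance
  obtain ⟨hpos, hpos'⟩ := tendsto_lintegral_isolProb_pos hd hf hlog
  obtain ⟨hneg, hneg'⟩ := tendsto_lintegral_isolProb_neg hd hf hQ
  obtain ⟨hlogi, hlim⟩ := integrable_log_and_integral_log hf hpos' hneg'
  have hmap : ∀ N : ℕ, P.map (fun ω (i : Fin N) => X i ω) = Measure.pi fun _ => law f := by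
    intro N
    have h := hindep.precomp (g := fun i : Fin N => (i : ℕ)) Fin.val_injective
    simpa only [hlaw] using (ProbabilityTheory.iIndepFun_iff_map_fun_eq_pi_map
      fun i : Fin N => (hX i).aemeasurable).1 h
  have hmeas : ∀ N : ℕ, Measurable fun ω (i : Fin N) => X i ω := fun N =>
    measurable_pi_lambda _ fun i => hX i
  have hest : ∀ n : ℕ, 0 < n → Integrable (estimator X (n + 1)) P ∧
      ∫ ω, estimator X (n + 1) ω ∂P =
        (∫⁻ t in Ioi 0, isolProb (law f) n (nnRadius d n t)).toReal -
        (∫⁻ t in Ioi 0, (1 - isolProb (law f) n (nnRadius d n (-t)))).toReal + eulerConst := by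
    intro n hn
    obtain ⟨h1, h2⟩ := integral_estimate_pi (law f) hd hn
      (lintegral_isolProb_nnRadius_ne_top (law f) hd hlog hn)
      (lintegral_one_sub_isolProb_ne_top hd hf hQ hn)
    rw [← hmap (n + 1)] at h1 h2
    refine ⟨h1.comp_measurable (hmeas _), ?_⟩
    rw [← h2, integral_map (hmeas _).aemeasurable h1.aestronglyMeasurable]
    rfl
  refine ⟨fun N hN => ?_, ?_, ?_⟩
  · obtain ⟨n, rfl⟩ : ∃ n, N = n + 1 := ⟨N - 1, by omega⟩
    exact (hest n (by omega)).1
  · rw [law, integrable_withDensity_iff_integrable_smul' hf.measurable.ennreal_ofReal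
      (ae_of_all _ fun _ => ENNReal.ofReal_lt_top)] at hlogi
    simpa only [ENNReal.toReal_ofReal (hf.nonneg _), smul_eq_mul] using hlogi
  · have hent : entropy f = -∫ x, Real.log (f x) ∂law f := by
      rw [law, integral_withDensity_eq_integral_toReal_smul hf.measurable.ennreal_ofReal
        (ae_of_all _ fun _ => ENNReal.ofReal_lt_top)]
      simp only [ENNReal.toReal_ofReal (hf.nonneg _), smul_eq_mul, entropy]
    -- A sample of size n + 1 gives each point n competitors.
    rw [← tendsto_add_atTop_iff_nat 1]
    have h := (((ENNReal.tendsto_toReal hpos').comp hpos).sub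
      ((ENNReal.tendsto_toReal hneg').comp hneg)).add_const eulerConst
    rw [hlim, show -eulerConst - ∫ x, Real.log (f x) ∂law f + eulerConst = entropy f by
      rw [hent]; ring] at h
    refine h.congr' ?_
    filter_upwards [eventually_gt_atTop 0] with n hn
    exact (hest n hn).2.symm

end

/-! ### The stated conditions imply the two requirements. -/

section

variable {d : ℕ} {f : E d → ℝ}

theorem finiteQ_of_condB (hd : 0 < d) (hf : IsProbDensity f) (hB : CondB f) : FiniteQ f := by
  have := isProbabilityMeasure_law hf
  obtain ⟨g, hg, M, -, hM⟩ := hB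
  refine ⟨1, 1, one_pos, one_pos, ?_⟩
  have hball : ∀ x r, 0 < r → ballAvg f x r ≤ ENNReal.ofReal M := by
    intro x r hr
    have hV := unitBallVol_pos d
    rw [ballAvg, ← volume_closedBall_eq hd x hr.le]
    refine ENNReal.div_le_of_le_mul ?_
    rw [← setLIntegral_const]
    refine lintegral_mono_ae (ae_restrict_of_ae ?_)
    filter_upwards [hg] with y hy
    exact ENNReal.ofReal_le_ofReal (hy ▸ hM y)
  have hmax : ∀ x, maxAvg f x 1 ≤ ENNReal.ofReal M := fun x =>
    iSup₂_le fun r hr => hball x r hr.1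
  calc Q f 1 1 = ∫⁻ x, maxAvg f x 1 ^ (1 : ℝ) ∂law f := (lintegral_law hf _).symm
    _ ≤ ∫⁻ _, ENNReal.ofReal M ∂law f := lintegral_mono fun x => by
        rw [ENNReal.rpow_one]; exact hmax x
    _ < ⊤ := by simp

theorem lintegral_log_dist_ne_top_of_condA (hf : IsProbDensity f) (hA : CondA f) :
    ∫⁻ x, ∫⁻ y, ENNReal.ofReal (Real.log (dist x y)) ∂law f ∂law f ≠ ⊤ := by
  have := isProbabilityMeasure_law hf
  obtain ⟨p, hp, hA⟩ := hA
  have hA' : ∫⁻ x, ∫⁻ y, ENNReal.ofReal (|Real.log (dist x y)| ^ p) ∂law f ∂law f < ⊤ := by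
    refine lt_of_eq_of_lt ?_ hA
    rw [lintegral_law hf]
    refine lintegral_congr fun x => ?_
    rw [lintegral_law hf, ← lintegral_mul_const' _ _ ENNReal.ofReal_ne_top]
    refine lintegral_congr fun y => ?_
    ring
  have hle : ∀ s : ℝ, ENNReal.ofReal s ≤ 1 + ENNReal.ofReal (|s| ^ p) := by
    intro s
    rw [← ENNReal.ofReal_one, ← ENNReal.ofReal_add zero_le_one (by positivity)]
    apply ENNReal.ofReal_le_ofReal
    rcases le_total |s| 1 with h | h
    · linarith [le_abs_self s, Real.rpow_nonneg (abs_nonneg s) p]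
    · have := Real.rpow_le_rpow_of_exponent_le h hp.le
      rw [Real.rpow_one] at this
      linarith [le_abs_self s]
  refine ne_top_of_le_ne_top (ENNReal.add_ne_top.2 ⟨ENNReal.one_ne_top, hA'.ne⟩) ?_
  calc _ ≤ ∫⁻ x, ∫⁻ y, (1 + ENNReal.ofReal (|Real.log (dist x y)| ^ p)) ∂law f ∂law f :=
        lintegral_mono fun x => lintegral_mono fun y => hle _
    _ = _ := by
        simp_rw [lintegral_add_left measurable_const]
        simp

/-- Beyond e the logarithm is at least 1, so G(|s|) ≥ |s|; below e the constant suffices. -/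
theorem le_add_G (s : ℝ) : s ≤ Real.exp 1 + G |s| := by
  have h0 := le_abs_self s
  have h1 : (1 : ℝ) < Real.exp 1 := Real.one_lt_exp_iff.2 one_pos
  unfold G
  split_ifs with h
  · linarith
  · have hs : 1 ≤ |s| := not_lt.1 h
    rcases le_total |s| (Real.exp 1) with h2 | h2
    · have := mul_nonneg (abs_nonneg s) (Real.log_nonneg hs)
      linarith
    · have := (Real.le_log_iff_exp_le (by linarith)).2 h2
      nlinarith [Real.exp_pos 1]

theorem lintegral_log_dist_ne_top_of_finiteK (hf : IsProbDensity f) (hK : FiniteK f) :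
    ∫⁻ x, ∫⁻ y, ENNReal.ofReal (Real.log (dist x y)) ∂law f ∂law f ≠ ⊤ := by
  have := isProbabilityMeasure_law hf
  obtain ⟨ε, hε, hK⟩ := hK
  have hK' : ∫⁻ x, (∫⁻ y, ENNReal.ofReal (G |Real.log (dist x y)|) ∂law f) ^ (1 + ε) ∂law f < ⊤ := by
    refine lt_of_eq_of_lt ?_ hK
    rw [lintegral_law hf]
    simp_rw [lintegral_law hf]
    rfl
  have hfin : ENNReal.ofReal (Real.exp 1) + 1 ≠ ⊤ :=
    ENNReal.add_ne_top.2 ⟨ENNReal.ofReal_ne_top, ENNReal.one_ne_top⟩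
  refine ne_top_of_le_ne_top (ENNReal.add_ne_top.2 ⟨hfin, hK'.ne⟩) ?_
  calc _ ≤ ∫⁻ x, (ENNReal.ofReal (Real.exp 1) + 1 +
        (∫⁻ y, ENNReal.ofReal (G |Real.log (dist x y)|) ∂law f) ^ (1 + ε)) ∂law f := by
        refine lintegral_mono fun x => ?_
        set I := ∫⁻ y, ENNReal.ofReal (G |Real.log (dist x y)|) ∂law f
        calc _ ≤ ∫⁻ y, (ENNReal.ofReal (Real.exp 1) +
              ENNReal.ofReal (G |Real.log (dist x y)|)) ∂law f :=
              lintegral_mono fun y => (ENNReal.ofReal_le_ofReal (le_add_G _)).trans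
                ENNReal.ofReal_add_le
          _ = ENNReal.ofReal (Real.exp 1) + I := by
              rw [lintegral_add_left measurable_const]
              simp [I]
          _ ≤ _ := by
              rw [add_assoc]
              gcongr
              -- The aim is I ≤ 1 + I^(1 + ε): compare with 1 when I ≤ 1, and with the power
              -- otherwise.
              rcases le_total I 1 with h | h
              · exact h.trans le_self_add
              · refine le_trans ?_ le_add_self
                calc I = I ^ (1 : ℝ) := (ENNReal.rpow_one I).symm
                  _ ≤ _ := ENNReal.rpow_le_rpow_of_exponent_le h (by linarith)
    _ = _ := by
        rw [lintegral_add_left measurable_const]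
        simp

theorem lintegral_log_dist_ne_top_of_boundedSupport (hf : IsProbDensity f)
    (hS : BoundedSupport f) :
    ∫⁻ x, ∫⁻ y, ENNReal.ofReal (Real.log (dist x y)) ∂law f ∂law f ≠ ⊤ := by
  have := isProbabilityMeasure_law hf
  obtain ⟨g, hg, hS⟩ := hS
  obtain ⟨C, hC⟩ := Metric.isBounded_iff.1 hS
  have hmem : ∀ᵐ x ∂law f, x ∈ supp g := by
    filter_upwards [ae_law_pos hf, (law_absolutelyContinuous f).ae_le hg] with x hx hgx
    change 0 < g x
    rwa [hgx]
  refine ne_top_of_le_ne_top (b := ENNReal.ofReal C) ENNReal.ofReal_ne_top ?_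
  calc _ ≤ ∫⁻ _, ∫⁻ _, ENNReal.ofReal C ∂law f ∂law f := by
        refine lintegral_mono_ae ?_
        filter_upwards [hmem] with x hx
        refine lintegral_mono_ae ?_
        filter_upwards [hmem] with y hy
        exact ENNReal.ofReal_le_ofReal ((Real.log_le_self dist_nonneg).trans (hC hx hy))
    _ = _ := by simp

end

end KL

theorem corollary2 {d : ℕ} (hd : 0 < d) {Ω : Type*} [MeasurableSpace Ω]
    (P : MeasureTheory.Measure Ω) [MeasureTheory.IsProbabilityMeasure P]
    (f : KL.E d → ℝ) (hf : KL.IsProbDensity f)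
    (X : ℕ → Ω → KL.E d) (hX : ∀ i, Measurable (X i))
    (hindep : ProbabilityTheory.iIndepFun X P)
    (hlaw : ∀ i, P.map (X i) = KL.law f) :
    ((KL.FiniteK f ∨ KL.CondA f) → (KL.FiniteQ f ∨ KL.CondB f) →
        (KL.FiniteT f ∨ KL.CondC1 f) → KL.AsympUnbiased P X f) ∧
    (KL.CondB f → KL.CondC1 f → KL.BoundedSupport f → KL.AsympUnbiased P X f) := by
  refine ⟨fun h1 h2 _ => ?_, fun hB _ hS => ?_⟩
  · refine KL.asympUnbiased_of_lintegral_log_dist hd hf hX hindep hlaw ?_ ?_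
    · exact h1.elim (KL.lintegral_log_dist_ne_top_of_finiteK hf)
        (KL.lintegral_log_dist_ne_top_of_condA hf)
    · exact h2.elim id (KL.finiteQ_of_condB hd hf)
  · exact KL.asympUnbiased_of_lintegral_log_dist hd hf hX hindep hlaw
      (KL.lintegral_log_dist_ne_top_of_boundedSupport hf hS) (KL.finiteQ_of_condB hd hf hB)
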